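/- Let $\kappa$ be a weakly compact cardinal (that is, $\kappa$ is an uncountable strongly inaccessible cardinal with the tree property: every tree of height $\kappa$ all of whose levels have size less than $\kappa$ has a cofinal branch). Let $I$ be an ideal on $\kappa$, i.e. a nonempty family of subsets of $\kappa$ closed under subsets and finite unions, which contains every $X\subseteq\kappa$ with $|X|<\kappa$. Write $I^+=\{X\subseteq\kappa : X\notin I\}$. Suppose that $I$ is normal: for every $S\in I^+$ and every $f:S\to\kappa$ with $f(\alpha)<\alpha$ for all $\alpha\in S$, there is $H\subseteq S$ with $H\in I^+$ on which $f$ is constant. Suppose also that $I$ is definable over $H(\kappa^+)$, i.e. $I$ is a subset of $H(\kappa^+)$ that is first-order definable in the structure $(H(\kappa^+),\in)$, parameters from $H(\kappa^+)$ being allowed; here $H(\kappa^+)$ is the collection of all sets whose transitive closure has size at most $\kappa$. Then $I$ is nowhere $\kappa$-saturated: for every $S\in I^+$ the ideal $I\upharpoonright S=\{X\subseteq\kappa : X\cap S\in I\}$ is not $\kappa$-saturated, where an ideal $J$ on $\kappa$ is $\kappa$-saturated if every family $\mathcal F\subseteq J^+$ with $X\cap Y\in J$ for all distinct $X,Y\in\mathcal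 F$ has size less than $\kappa$. -/

import Mathlib

universe u

namespace SetIdeal

open Cardinal Set

/-! ### Weakly compact cardinals -/

section Trees

variable {T : Type u} [PartialOrder T] [∀ t : T, IsWellOrder (Iio t) (· < ·)]

/-- The height of a node `t` of a tree: the order type of the set of predecessors of `t`. -/
noncomputable def height (t : T) : Ordinal.{u} :=
  Ordinal.type (fun a b : Iio t => a < b)

variable (T) in
/-- The `α`-th level of a tree. -/
def level (α : Ordinal.{u}) : Set T :=
  {t | height t = α}

end Trees

/-- The tree property of `κ`: every `κ`-tree (a tree of height `κ`, all of whose levels have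
size less than `κ`) has a cofinal branch, i.e. a chain that meets every level. -/
def TreeProperty (κ : Cardinal.{u}) : Prop :=
  ∀ (T : Type u) [PartialOrder T] [∀ t : T, IsWellOrder (Iio t) (· < ·)],
    (∀ t : T, height t < κ.ord) →
    (∀ α < κ.ord, (level T α).Nonempty) →
    (∀ α < κ.ord, #(level T α) < κ) →
    ∃ b : Set T, IsChain (· ≤ ·) b ∧ ∀ α < κ.ord, (b ∩ level T α).Nonempty

/-- A cardinal is weakly compact if it is (strongly) inaccessible, in particular uncountable, and
has the tree property. -/
structure IsWeaklyCompact (κ : Cardinal.{u}) : Prop where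
  isInaccessible : κ.IsInaccessible
  treeProperty : TreeProperty κ

/-! ### Ideals on a cardinal

The cardinal `κ` is identified with the set `Iio κ.ord` of the ordinals below it, and an ideal
on `κ` is an `Order.Ideal (Set (Iio κ.ord))`: a nonempty family of subsets of `κ` that is closed
under subsets and finite unions. The improper ideal is allowed. -/

/-- The restriction `I ↾ S = {X | X ∩ S ∈ I}` of an ideal. -/
def restrict {A : Type*} (I : Order.Ideal (Set A)) (S : Set A) : Order.Ideal (Set A) where
  carrier := {X | X ∩ S ∈ I}
  lower' := fun _ _ hYX hX => I.lower (inter_subset_inter_left S hYX) hX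
  nonempty' := ⟨∅, by simpa using I.bot_mem⟩
  directed' := fun X hX Y hY => ⟨X ∪ Y, by
    have h : (X ∩ S) ∪ (Y ∩ S) ∈ I := Order.Ideal.sup_mem hX hY
    rw [← union_inter_distrib_right] at h
    exact h, subset_union_left, subset_union_right⟩

/-- Normality of an ideal on `κ`: every regressive function on an `I`-positive set is constant on
an `I`-positive subset. -/
def IsNormal {κ : Cardinal.{u}} (I : Order.Ideal (Set (Iio κ.ord))) : Prop :=
  ∀ S : Set (Iio κ.ord), S ∉ I → ∀ f : Iio κ.ord → Iio κ.ord, (∀ α ∈ S, f α < α) →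
    ∃ H ⊆ S, H ∉ I ∧ ∃ γ, ∀ α ∈ H, f α = γ

/-- An ideal `I` is `μ`-saturated if the quotient Boolean algebra modulo `I` has the `μ`-chain
condition: every family of `I`-positive sets with pairwise intersections in `I` has size
less than `μ`. -/
def IsSaturated {A : Type (u + 1)} (I : Order.Ideal (Set A)) (μ : Cardinal.{u}) : Prop :=
  ∀ F : Set (Set A), (∀ X ∈ F, X ∉ I) → F.Pairwise (fun X Y => X ∩ Y ∈ I) →
    #F < Cardinal.lift.{u + 1} μ

/-- An ideal `I` is nowhere `μ`-saturated if no restriction of `I` to an `I`-positive set is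
`μ`-saturated. -/
def IsNowhereSaturated {A : Type (u + 1)} (I : Order.Ideal (Set A)) (μ : Cardinal.{u}) : Prop :=
  ∀ S : Set A, S ∉ I → ¬ IsSaturated (restrict I S) μ

/-! ### Definability over `H(θ)` -/

/-- `H(θ)`, the collection of the sets whose transitive closure has size less than `θ`,
equivalently, those that are contained in a transitive set of size less than `θ`. -/
def H (θ : Cardinal.{u}) : Set ZFSet.{u} :=
  {x | ∃ t : ZFSet.{u}, t.IsTransitive ∧ x ⊆ t ∧ t.card < θ}

/-- The relation symbols of the language of set theory: one binary symbol. -/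
inductive MemRel : ℕ → Type
  | mem : MemRel 2

/-- The first-order language of set theory. -/
def setLanguage : FirstOrder.Language.{0, 0} := ⟨fun _ => Empty, MemRel⟩

/-- `H(θ)` as a structure for the language of set theory, with the true membership relation. -/
instance instStructureH (θ : Cardinal.{u}) : setLanguage.Structure (H θ) where
  funMap := fun f => nomatch f
  RelMap := fun r => match r with
    | .mem => fun v => (v 0 : ZFSet.{u}) ∈ (v 1 : ZFSet.{u})

/-- The set in the sense of `ZFSet` (a set of von Neumann ordinals) given by a subset of `κ`. -/
noncomputable def code {κ : Cardinal.{u}} (X : Set (Iio κ.ord)) : ZFSet.{u} :=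
  ZFSet.sep (fun x => ∃ α ∈ X, α.1.toZFSet = x) κ.ord.toZFSet

/-- A family `I` of subsets of `κ` is definable over `H(κ⁺)`: it is a subset of `H(κ⁺)` that is
first-order definable in `(H(κ⁺), ∈)`, with parameters from `H(κ⁺)`. -/
def IsDefinableOverH {κ : Cardinal.{u}} (I : Order.Ideal (Set (Iio κ.ord))) : Prop :=
  (univ : Set (H (Order.succ κ))).Definable₁ setLanguage
    {x | ∃ X ∈ I, code X = (x : ZFSet.{u})}

end SetIdeal

namespace SetIdeal

open Cardinal Set

/-! Suppose `I ↾ S` is `κ`-saturated. If `I` had no atom, every positive set would split into two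
positive halves. Splitting `S` repeatedly gives a tree of positive cells whose levels are small by
saturation and nonempty by normality and inaccessibility. A cofinal branch sheds a positive piece at
each of `κ` stages, and these pieces are disjoint, contradicting saturation. So `I` has an atom `A`
(`exists_atom`), and `{X | A ∩ X ∉ I}` is a normal ultrafilter `U` (`exists_isNormalUltrafilter`).

The rest is a concrete form of the fact that a normal ultrafilter is not in its own ultrapower,
while `H(κ⁺)` is. Elements of `H(κ⁺)` are coded by relations on `κ`; restricting codes to `α` and
collapsing gives a structure `slice α`. By normality, `H(κ⁺)` behaves as the ultraproduct of the
slices, so Łoś's theorem holds (`realize_valH_iff`). A definition of `I` over `H(κ⁺)` would then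
decide `X ∈ U` from the sets `X ∩ α` for `U`-almost all `α`, which a diagonal set refutes
(`not_forall_mem_iff_eventually_inter_Iio`). -/

theorem mk_Iio_subtype_lt {κ : Cardinal.{u}} (α : Iio κ.ord) :
    #(Iio α) < Cardinal.lift.{u + 1} κ := by
  have h : #(Iio α) ≤ #(Iio α.1) :=
    mk_le_of_injective (f := fun x : Iio α => (⟨x.1.1, x.2⟩ : Iio α.1))
      (fun x y h => Subtype.ext (Subtype.ext (Subtype.mk.inj h)))
  refine h.trans_lt ?_
  rw [mk_Iio_ordinal, Cardinal.lift_lt]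
  exact Cardinal.lt_ord.1 α.2

theorem exists_gt_of_aleph0_le {κ : Cardinal.{u}} (hκ : ℵ₀ ≤ κ) (α : Iio κ.ord) :
    ∃ β : Iio κ.ord, α < β ∧ ∀ γ, γ < β → γ ≤ α :=
  ⟨⟨Order.succ α.1, (Cardinal.isSuccLimit_ord hκ).succ_lt α.2⟩, Order.lt_succ α.1,
    fun γ h => (Order.lt_succ_iff (a := γ.1)).1 h⟩

/-! ### Completeness of normal ideals -/

section Ideal

variable {κ : Cardinal.{u}} {I : Order.Ideal (Set (Iio κ.ord))}

theorem Iio_mem (hsmall : ∀ X : Set (Iio κ.ord), #X < Cardinal.lift.{u + 1} κ → X ∈ I)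
    (α : Iio κ.ord) : Iio α ∈ I :=
  hsmall _ (mk_Iio_subtype_lt α)

theorem Iic_mem (hκ : ℵ₀ ≤ κ)
    (hsmall : ∀ X : Set (Iio κ.ord), #X < Cardinal.lift.{u + 1} κ → X ∈ I)
    (α : Iio κ.ord) : Iic α ∈ I := by
  obtain ⟨β, hβ, -⟩ := exists_gt_of_aleph0_le hκ α
  exact I.lower (fun x hx => lt_of_le_of_lt hx hβ) (Iio_mem hsmall β)

theorem diff_notMem {S Y : Set (Iio κ.ord)} (hS : S ∉ I) (hY : Y ∈ I) : S \ Y ∉ I := fun h =>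
  hS (I.lower (show S ≤ (S \ Y) ⊔ Y from fun x hx => by
    by_cases hxY : x ∈ Y
    · exact Or.inr hxY
    · exact Or.inl ⟨hx, hxY⟩) (Order.Ideal.sup_mem h hY))

/-- This is `κ`-completeness: a function with fewer than `κ` values becomes regressive once its
values are enumerated in type `μ < κ` and the points below `μ` are dropped. -/
theorem exists_fiber_notMem
    (hsmall : ∀ X : Set (Iio κ.ord), #X < Cardinal.lift.{u + 1} κ → X ∈ I)
    (hnormal : IsNormal I) {S : Set (Iio κ.ord)} (hS : S ∉ I) {Y : Type (u + 1)}
    (f : Iio κ.ord → Y) (hf : #(range f) < Cardinal.lift.{u + 1} κ) :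
    ∃ x ∈ S, {y ∈ S | f y = f x} ∉ I := by
  obtain ⟨μ, hμκ, hμ⟩ := Cardinal.lt_lift_iff.1 hf
  have hμκ' : μ.ord < κ.ord := Cardinal.ord_lt_ord.2 hμκ
  have he : #(range f) = #(Iio μ.ord) := by rw [mk_Iio_ordinal, card_ord, hμ]
  obtain ⟨e⟩ := Cardinal.eq.1 he
  let g : Iio κ.ord → Iio κ.ord := fun x =>
    ⟨(e ⟨f x, mem_range_self x⟩).1, lt_trans (e ⟨f x, mem_range_self x⟩).2 hμκ'⟩
  have hS' := diff_notMem hS (Iio_mem hsmall ⟨μ.ord, hμκ'⟩)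
  obtain ⟨H, hHS, hH, γ, hγ⟩ := hnormal _ hS' g fun α hα =>
    lt_of_lt_of_le (show g α < ⟨μ.ord, hμκ'⟩ from (e ⟨f α, mem_range_self α⟩).2) (not_lt.1 hα.2)
  obtain ⟨x, hx⟩ : H.Nonempty := by
    rw [nonempty_iff_ne_empty]
    rintro rfl
    exact hH I.bot_mem
  refine ⟨x, (hHS hx).1, fun h => hH (I.lower
    (show H ≤ {y ∈ S | f y = f x} from fun y hy => ⟨(hHS hy).1, ?_⟩) h)⟩
  have h1 : g y = g x := (hγ y hy).trans (hγ x hx).symm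
  have h2 := e.injective (Subtype.ext (Subtype.mk.inj h1))
  exact congrArg Subtype.val h2

end Ideal

/-! ### The tree property for trees given by a rank function -/

/-- The hypotheses make `ht` an isomorphism from the predecessors of `t` onto the ordinals below `ht
t`, so `ht` is the height function. -/
theorem TreeProperty.exists_branch_of_rank {κ : Cardinal.{u}} (hκ : TreeProperty κ) {T : Type u}
    [PartialOrder T] (ht : T → Iio κ.ord) (hmono : StrictMono ht)
    (hpred : ∀ t, ∀ α < ht t, ∃ s < t, ht s = α)
    (hcmp : ∀ t s s', s < t → s' < t → ht s ≤ ht s' → s ≤ s')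
    (hne : ∀ α, ∃ t, ht t = α) (hcard : ∀ α, #{t | ht t = α} < κ) :
    ∃ b : Iio κ.ord → T, (∀ α, ht (b α) = α) ∧ Monotone b := by
  have hwo : ∀ t : T, IsWellOrder (Iio t) (· < ·) := fun t =>
    { wf := Subrelation.wf (r := InvImage (· < ·) fun s : Iio t => ht s.1)
        (fun h => hmono h) (InvImage.wf _ wellFounded_lt)
      trichotomous := fun a b h1 h2 => by
        rcases le_total (ht a.1) (ht b.1) with h | h
        · exact Subtype.ext ((hcmp t _ _ a.2 b.2 h).eq_of_not_lt h1)
        · exact Subtype.ext ((hcmp t _ _ b.2 a.2 h).eq_of_not_lt h2).symm }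
  have hheight : ∀ t : T, height t = (ht t).1 := by
    intro t
    let f : Iio t → Iio (ht t).1 := fun s => ⟨(ht s.1).1, hmono s.2⟩
    have hf : Function.Surjective f := by
      rintro ⟨α, hα⟩
      obtain ⟨s, hs, h⟩ := hpred t ⟨α, lt_trans (mem_Iio.1 hα) (mem_Iio.1 (ht t).2)⟩ hα
      exact ⟨⟨s, hs⟩, Subtype.ext (congrArg (fun x => x.1) h)⟩
    let e : (fun a b : Iio t => a < b) ↪r (fun a b : Iio (ht t).1 => a < b) :=
      RelEmbedding.ofMonotone f fun a b h => hmono h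
    have h := Ordinal.lift_type_eq.{u, u + 1, 0}.2 ⟨RelIso.ofSurjective e hf⟩
    rw [Ordinal.type_lt_Iio, Ordinal.lift_lift] at h
    exact Ordinal.lift_inj.{u + 1, u}.1 h
  have hlevel : ∀ α : Iio κ.ord, level T α.1 = {t | ht t = α} := fun α => by
    ext t
    exact ⟨fun h => Subtype.ext ((hheight t).symm.trans h),
      fun h => (hheight t).trans (congrArg Subtype.val h)⟩
  obtain ⟨b, hb, hbl⟩ := hκ T (fun t => by rw [hheight]; exact (ht t).2)
    (fun α hα => by
      rw [hlevel ⟨α, hα⟩]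
      exact hne ⟨α, hα⟩)
    (fun α hα => by
      rw [hlevel ⟨α, hα⟩]
      exact hcard ⟨α, hα⟩)
  choose c hcb hc using fun α : Iio κ.ord => hbl α.1 α.2
  have hc' : ∀ α, ht (c α) = α := fun α => by
    have := hc α
    rwa [hlevel] at this
  refine ⟨c, hc', fun α β hαβ => ?_⟩
  rcases eq_or_ne (c α) (c β) with h | h
  · exact h.le
  · rcases hb (hcb α) (hcb β) h with h' | h'
    · exact h'
    · have := hmono (lt_of_le_of_ne h' h.symm)
      rw [hc', hc'] at this
      exact absurd this hαβ.not_gt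

theorem TreeProperty.exists_branch {κ : Cardinal.{u}} (hκ : TreeProperty κ) {T : Type (u + 1)}
    [Small.{u} T] [PartialOrder T] (ht : T → Iio κ.ord) (hmono : StrictMono ht)
    (hpred : ∀ t, ∀ α < ht t, ∃ s < t, ht s = α)
    (hcmp : ∀ t s s', s < t → s' < t → ht s ≤ ht s' → s ≤ s')
    (hne : ∀ α, ∃ t, ht t = α) (hcard : ∀ α, #{t | ht t = α} < Cardinal.lift.{u + 1} κ) :
    ∃ b : Iio κ.ord → T, (∀ α, ht (b α) = α) ∧ Monotone b := by
  let e := (equivShrink.{u} T).symm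
  let _ : PartialOrder (Shrink.{u} T) := PartialOrder.lift e e.injective
  obtain ⟨b, hb, hbm⟩ := hκ.exists_branch_of_rank (T := Shrink.{u} T) (fun t => ht (e t))
    (fun s t h => hmono h)
    (fun t α hα => by
      obtain ⟨s, hs, h⟩ := hpred _ α hα
      exact ⟨e.symm s, show e (e.symm s) < e t by rwa [e.apply_symm_apply],
        by rwa [e.apply_symm_apply]⟩)
    (fun t s s' h1 h2 h => hcmp (e t) (e s) (e s') h1 h2 h)
    (fun α => by
      obtain ⟨t, h⟩ := hne α
      exact ⟨e.symm t, by rwa [e.apply_symm_apply]⟩)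
    (fun α => by
      rw [← Cardinal.lift_lt.{u, u + 1}]
      refine lt_of_le_of_lt ?_ (hcard α)
      have h := Cardinal.mk_le_of_injective
        (f := fun x : ULift.{u + 1} {t : Shrink.{u} T | ht (e t) = α} =>
          (⟨e x.down.1, x.down.2⟩ : {t | ht t = α}))
        (fun x y h => ULift.ext _ _ (Subtype.ext (e.injective (congrArg Subtype.val h))))
      rwa [Cardinal.mk_uLift] at h)
  exact ⟨fun α => e (b α), hb, hbm⟩

/-! ### The splitting tree of a set -/

section Splitting

variable {ι X : Type*} [LinearOrder ι] [WellFoundedLT ι] (B : Set X → Set X) (S : Set X)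

/-- Split `S` repeatedly along `ι`, each cell `C` being divided into `C ∩ B C` and `C \ B C`:
`splitBit B S α x` says that `x` goes to the first half at stage `α`. -/
def splitBit : ι → X → Prop :=
  wellFounded_lt.fix fun α ih x => x ∈ B {y ∈ S | ∀ β (h : β < α), ih β h y ↔ ih β h x}

/-- The cell of `x` at stage `α` of the repeated splitting of `S`. -/
def splitCell (α : ι) (x : X) : Set X :=
  {y ∈ S | ∀ β < α, splitBit B S β y ↔ splitBit B S β x}

theorem splitBit_iff (α : ι) (x : X) : splitBit B S α x ↔ x ∈ B (splitCell B S α x) := by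
  unfold splitBit
  rw [wellFounded_lt.fix_eq]
  rfl

variable {B S}

theorem mem_splitCell_self {α : ι} {x : X} (hx : x ∈ S) : x ∈ splitCell B S α x :=
  ⟨hx, fun _ _ => Iff.rfl⟩

theorem splitCell_subset {α : ι} {x : X} : splitCell B S α x ⊆ S := fun _ h => h.1

theorem splitCell_eq {α : ι} {x y : X} (h : y ∈ splitCell B S α x) :
    splitCell B S α y = splitCell B S α x := by
  ext z
  exact ⟨fun hz => ⟨hz.1, fun β hβ => (hz.2 β hβ).trans (h.2 β hβ)⟩,
    fun hz => ⟨hz.1, fun β hβ => (hz.2 β hβ).trans (h.2 β hβ).symm⟩⟩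

theorem splitCell_anti {α β : ι} (h : α ≤ β) (x : X) :
    splitCell B S β x ⊆ splitCell B S α x :=
  fun _ hy => ⟨hy.1, fun γ hγ => hy.2 γ (hγ.trans_le h)⟩

theorem mem_splitCell_of_covBy {α β : ι} (hαβ : α < β) (h : ∀ γ < β, γ ≤ α) {x y : X} :
    y ∈ splitCell B S β x ↔
      y ∈ splitCell B S α x ∧ (y ∈ B (splitCell B S α x) ↔ x ∈ B (splitCell B S α x)) := by
  have key : y ∈ splitCell B S α x →
      ((splitBit B S α y ↔ splitBit B S α x) ↔
        (y ∈ B (splitCell B S α x) ↔ x ∈ B (splitCell B S α x))) := fun hy => by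
    rw [splitBit_iff, splitBit_iff, splitCell_eq hy]
  constructor
  · intro hy
    have hy' := splitCell_anti hαβ.le x hy
    exact ⟨hy', (key hy').1 (hy.2 α hαβ)⟩
  · rintro ⟨hy, hyB⟩
    refine ⟨hy.1, fun γ hγ => ?_⟩
    rcases (h γ hγ).lt_or_eq with h' | rfl
    · exact hy.2 γ h'
    · exact (key hy).2 hyB

end Splitting

/-! ### Atoms from saturation and the tree property -/

section Atoms

variable {κ : Cardinal.{u}} {I : Order.Ideal (Set (Iio κ.ord))}

/-- A cell at stage `α` is determined by a sequence of `α` bits, and there are fewer than `κ` such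
sequences because `κ` is a strong limit. -/
theorem exists_splitCell_notMem (hκ : κ.IsInaccessible)
    (hsmall : ∀ X : Set (Iio κ.ord), #X < Cardinal.lift.{u + 1} κ → X ∈ I)
    (hnormal : IsNormal I) {S : Set (Iio κ.ord)} (hS : S ∉ I)
    (B : Set (Iio κ.ord) → Set (Iio κ.ord)) (α : Iio κ.ord) :
    ∃ x ∈ S, splitCell B S α x ∉ I := by
  let f : Iio κ.ord → Set (Iio α) := fun x => {γ | splitBit B S γ.1 x}
  obtain ⟨x, hx, h⟩ := exists_fiber_notMem hsmall hnormal hS f (by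
    refine (mk_set_le _).trans_lt ?_
    obtain ⟨μ, hμ, h⟩ := Cardinal.lt_lift_iff.1 (mk_Iio_subtype_lt α)
    rw [mk_set, ← h, ← Cardinal.lift_two_power, Cardinal.lift_lt]
    exact hκ.isStrongPrelimit hμ)
  refine ⟨x, hx, fun h' => h (I.lower ?_ h')⟩
  rintro y ⟨hy, hyx⟩
  exact ⟨hy, fun β hβ => Set.ext_iff.1 hyx ⟨β, hβ⟩⟩

/-- On a weakly compact cardinal, a saturated restriction of a normal ideal has an atom. -/
theorem exists_atom (hκ : IsWeaklyCompact κ)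
    (hsmall : ∀ X : Set (Iio κ.ord), #X < Cardinal.lift.{u + 1} κ → X ∈ I)
    (hnormal : IsNormal I) {S : Set (Iio κ.ord)} (hS : S ∉ I)
    (hsat : IsSaturated (restrict I S) κ) :
    ∃ A ∉ I, ∀ X, A ∩ X ∈ I ∨ A \ X ∈ I := by
  by_contra! hatom
  choose! B hB hB' using hatom
  have hsat' : ∀ F : Set (Set (Iio κ.ord)), (∀ X ∈ F, X ⊆ S ∧ X ∉ I) → F.Pairwise Disjoint →
      #F < Cardinal.lift.{u + 1} κ := fun F hF hd => hsat F
    (fun X hX h => (hF X hX).2 (by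
      have h' : X ∩ S ∈ I := h
      rwa [inter_eq_self_of_subset_left (hF X hX).1] at h'))
    (fun X hX Y hY hXY => by
      show X ∩ Y ∩ S ∈ I
      rw [(hd hX hY hXY).inter_eq, empty_inter]
      exact I.bot_mem)
  -- Nodes are positive cells tagged by their stage, since one cell may recur at several stages;
  -- later and smaller means higher in the tree.
  let T := {p : Iio κ.ord × (Set (Iio κ.ord))ᵒᵈ //
    OrderDual.ofDual p.2 ∉ I ∧ ∃ x ∈ S, splitCell B S p.1 x = OrderDual.ofDual p.2}
  have : Small.{u} (Set (Iio κ.ord))ᵒᵈ := inferInstanceAs (Small.{u} (Set (Iio κ.ord)))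
  let C : T → Set (Iio κ.ord) := fun t => OrderDual.ofDual t.1.2
  let ht : T → Iio κ.ord := fun t => t.1.1
  have hCne : ∀ t : T, ∃ x ∈ S, x ∈ C t := fun t => by
    obtain ⟨x, hx, h⟩ := t.2.2
    exact ⟨x, hx, by
      have h' : splitCell B S t.1.1 x = C t := h
      exact h' ▸ mem_splitCell_self hx⟩
  have hC : ∀ (t : T) (x), x ∈ C t → C t = splitCell B S (ht t) x := fun t x hxt => by
    obtain ⟨y, -, h⟩ := t.2.2
    have h' : splitCell B S (ht t) y = C t := h
    rw [← h'] at hxt ⊢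
    exact (splitCell_eq hxt).symm
  have hle : ∀ {s t : T}, s ≤ t ↔ ht s ≤ ht t ∧ C t ⊆ C s := Iff.rfl
  obtain ⟨b, hb, hbm⟩ := hκ.treeProperty.exists_branch (T := T) ht
    (fun s t hst => by
      refine lt_of_le_of_ne (hle.1 hst.le).1 fun h => hst.not_ge ?_
      obtain ⟨x, -, hx⟩ := hCne t
      refine hle.2 ⟨h.ge, ?_⟩
      rw [hC t x hx, hC s x ((hle.1 hst.le).2 hx), h])
    (fun t α hα => by
      obtain ⟨x, hxS, hx⟩ := hCne t
      have hsub : C t ⊆ splitCell B S α x := by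
        rw [hC t x hx]
        exact splitCell_anti hα.le x
      refine ⟨⟨(α, OrderDual.toDual (splitCell B S α x)), fun h => t.2.1 (I.lower hsub h),
        x, hxS, rfl⟩, lt_of_le_not_ge (hle.2 ⟨hα.le, hsub⟩) fun h => ?_, rfl⟩
      exact (hle.1 h).1.not_gt hα)
    (fun t s s' hs hs' h => by
      obtain ⟨x, -, hx⟩ := hCne t
      refine hle.2 ⟨h, ?_⟩
      rw [hC s x ((hle.1 hs.le).2 hx), hC s' x ((hle.1 hs'.le).2 hx)]
      exact splitCell_anti h x)
    (fun α => by
      obtain ⟨x, hxS, hx⟩ := exists_splitCell_notMem hκ.isInaccessible hsmall hnormal hS B α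
      exact ⟨⟨(α, OrderDual.toDual (splitCell B S α x)), hx, x, hxS, rfl⟩, rfl⟩)
    (fun α => by
      refine lt_of_le_of_lt ?_ (hsat' (C '' {t | ht t = α}) ?_ ?_)
      · rw [mk_image_eq_of_injOn]
        intro s hs t ht' hst
        exact Subtype.ext (Prod.ext (hs.trans ht'.symm) hst)
      · rintro _ ⟨t, -, rfl⟩
        obtain ⟨x, -, hx⟩ := hCne t
        refine ⟨?_, t.2.1⟩
        rw [hC t x hx]
        exact splitCell_subset
      · rintro _ ⟨s, hs, rfl⟩ _ ⟨t, ht', rfl⟩ hst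
        rw [Set.disjoint_left]
        intro x hxs hxt
        exact hst (by rw [hC s x hxs, hC t x hxt, show ht s = α from hs, show ht t = α from ht']))
  choose σ hσ hσ' using exists_gt_of_aleph0_le hκ.isInaccessible.aleph0_lt.le
  -- `D α` is the half that the branch leaves behind at stage `α`; it is positive whichever half the
  -- branch follows.
  let D : Iio κ.ord → Set (Iio κ.ord) := fun α => C (b α) \ C (b (σ α))
  have hsubS : ∀ t, C t ⊆ S := fun t => by
    obtain ⟨x, -, hx⟩ := hCne t
    rw [hC t x hx]
    exact splitCell_subset
  have hD : ∀ α, D α ∉ I := by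
    intro α h
    obtain ⟨x, -, hx⟩ := hCne (b (σ α))
    have hx' := (hle.1 (hbm (hσ α).le)).2 hx
    have h1 := hC _ x hx
    have h2 := hC _ x hx'
    rw [hb] at h1 h2
    have hpos : splitCell B S α x ∉ I := h2 ▸ (b α).2.1
    have hD' : D α = splitCell B S α x \ splitCell B S (σ α) x := by rw [← h1, ← h2]
    rw [hD'] at h
    by_cases hxB : x ∈ B (splitCell B S α x)
    · refine hB' _ hpos (I.lower ?_ h)
      rintro y ⟨hy, hyB⟩
      exact ⟨hy, fun hy' => hyB (((mem_splitCell_of_covBy (hσ α) (hσ' α)).1 hy').2.2 hxB)⟩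
    · refine hB _ hpos (I.lower ?_ h)
      rintro y ⟨hy, hyB⟩
      exact ⟨hy, fun hy' => hxB (((mem_splitCell_of_covBy (hσ α) (hσ' α)).1 hy').2.1 hyB)⟩
  have hdisj : ∀ α β, α < β → Disjoint (D α) (D β) := fun α β hαβ => by
    rw [Set.disjoint_left]
    intro x hxα hxβ
    refine hxα.2 ((hle.1 (hbm (?_ : σ α ≤ β))).2 hxβ.1)
    exact not_lt.1 fun h => (hσ' α β h).not_gt hαβ
  have hdisj' : ∀ α β, α ≠ β → Disjoint (D α) (D β) := fun α β hαβ => by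
    rcases hαβ.lt_or_gt with h | h
    · exact hdisj α β h
    · exact (hdisj β α h).symm
  have hinj : Function.Injective D := fun α β h => by
    by_contra hne
    have := hdisj' α β hne
    rw [h, disjoint_self] at this
    exact hD β (this ▸ I.bot_mem)
  have hlt := hsat' (range D)
    (by
      rintro _ ⟨α, rfl⟩
      exact ⟨sdiff_subset.trans (hsubS _), hD α⟩)
    (by
      rintro _ ⟨α, rfl⟩ _ ⟨β, rfl⟩ h
      exact hdisj' α β fun h' => h (congrArg D h'))
  rw [mk_range_eq D hinj, mk_Iio_ordinal, card_ord] at hlt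
  exact lt_irrefl _ hlt

end Atoms

/-! ### Normal ultrafilters -/

section NormalUltrafilter

variable {ι : Type*} [LinearOrder ι]

/-- An ultrafilter on a linear order is normal if it contains all final segments `Ioi ξ` and every
regressive function is constant on a set in it. -/
structure IsNormalUltrafilter (U : Ultrafilter ι) : Prop where
  eventually_gt : ∀ ξ, ∀ᶠ α in (U : Filter ι), ξ < α
  eventually_eq_of_regressive : ∀ f : ι → ι,
    (∀ᶠ α in (U : Filter ι), f α < α) → ∃ γ, ∀ᶠ α in (U : Filter ι), f α = γ

namespace IsNormalUltrafilter

/-- Closure under diagonal intersections: otherwise choosing a failing `ξ < α` is regressive, hence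
constant on a set in `U`, against `h` at that constant. -/
theorem eventually_forall_lt {U : Ultrafilter ι} (hU : IsNormalUltrafilter U)
    {Q : ι → ι → Prop} (h : ∀ ξ, ∀ᶠ α in U, Q ξ α) :
    ∀ᶠ α in U, ∀ ξ < α, Q ξ α := by
  classical
  by_contra hcon
  rw [← Ultrafilter.eventually_not] at hcon
  push Not at hcon
  let f : ι → ι := fun α => if h : ∃ ξ < α, ¬ Q ξ α then h.choose else α
  have hf : ∀ᶠ α in U, f α < α ∧ ¬ Q (f α) α := hcon.mono fun α hα => by
    simp only [f, dif_pos hα]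
    exact hα.choose_spec
  obtain ⟨γ, hγ⟩ := hU.eventually_eq_of_regressive f (hf.mono fun _ h => h.1)
  obtain ⟨α, ⟨h1, h2⟩, h3⟩ := ((hf.and hγ).and (h γ)).exists
  exact h1.2 (h2 ▸ h3)

/-- Reflection of `∀∃` statements to almost all `α`. Forwards, almost every `α` is closed under a
choice of witnesses; backwards, if `ξ` has no witness, then by diagonal intersection almost no `α`
has one below it. -/
theorem forall_exists_iff {U : Ultrafilter ι} (hU : IsNormalUltrafilter U) {A A' : Set ι}
    {p : ι → ι → Prop} {q : ι → ι → ι → Prop}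
    (h : ∀ ξ ∈ A, ∀ η ∈ A', p ξ η ↔ ∀ᶠ α in U, q α ξ η) :
    (∀ ξ ∈ A, ∃ η ∈ A', p ξ η) ↔
      ∀ᶠ α in U, ∀ ξ ∈ A, ξ < α → ∃ η ∈ A', η < α ∧ q α ξ η := by
  constructor
  · intro hp
    choose! g hg hpg using hp
    have h1 : ∀ ξ, ∀ᶠ α in U, ξ ∈ A → g ξ < α ∧ q α ξ (g ξ) := fun ξ => by
      by_cases hξ : ξ ∈ A
      · filter_upwards [hU.eventually_gt (g ξ), (h ξ hξ _ (hg ξ hξ)).1 (hpg ξ hξ)] with α h1 h2 _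
        exact ⟨h1, h2⟩
      · exact Filter.Eventually.of_forall fun α h => absurd h hξ
    filter_upwards [hU.eventually_forall_lt h1] with α hα ξ hξ hξα
    exact ⟨g ξ, hg ξ hξ, hα ξ hξα hξ⟩
  · intro hq
    by_contra! hp
    obtain ⟨ξ, hξ, hp⟩ := hp
    have h1 : ∀ η, ∀ᶠ α in U, η ∈ A' → ¬ q α ξ η := fun η => by
      by_cases hη : η ∈ A'
      · have := mt (h ξ hξ η hη).2 (hp η hη)
        rw [← Ultrafilter.eventually_not] at this
        exact this.mono fun _ h _ => h
      · exact Filter.Eventually.of_forall fun α h => absurd h hη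
    obtain ⟨α, ⟨h2, h3⟩, h4⟩ :=
      ((hq.and (hU.eventually_gt ξ)).and (hU.eventually_forall_lt h1)).exists
    obtain ⟨η, hη, hηα, hqη⟩ := h2 ξ hξ h3
    exact h4 η hηα hη hqη

end IsNormalUltrafilter

/-- An ultrafilter cannot be computed from the initial segments of its elements. -/
theorem not_forall_mem_iff_eventually_inter_Iio [WellFoundedLT ι]
    (U : Ultrafilter ι) (Q : ι → Set ι → Prop) :
    ¬ ∀ X, X ∈ U ↔ ∀ᶠ α in U, Q α (X ∩ Iio α) := by
  intro h
  -- The diagonal set, built by recursion: `α` is put in exactly when `Q` fails for the part already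
  -- built below `α`.
  let d : ι → Prop := wellFounded_lt.fix fun α ih => ¬ Q α {β | ∃ h : β < α, ih β h}
  have hd : ∀ α, d α ↔ ¬ Q α ({β | d β} ∩ Iio α) := fun α => by
    have h1 : d α = ¬ Q α {β | ∃ _ : β < α, d β} := wellFounded_lt.fix_eq _ _
    have h2 : {β | ∃ _ : β < α, d β} = {β | d β} ∩ Iio α := by
      ext β
      exact ⟨fun ⟨h, h'⟩ => ⟨h', h⟩, fun ⟨h', h⟩ => ⟨h, h'⟩⟩
    rw [h1, h2]
  have h1 := h {β | d β}
  have h2 : {β | d β} ∈ U ↔ ∀ᶠ α in U, ¬ Q α ({β | d β} ∩ Iio α) :=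
    Filter.eventually_congr (Filter.Eventually.of_forall hd)
  rw [Ultrafilter.eventually_not, ← h1] at h2
  tauto

end NormalUltrafilter

/-- On an atom, positive and measure one coincide, so the filter dual to `I ↾ A` is an ultrafilter
and normality of `I` passes to it. -/
theorem exists_isNormalUltrafilter {κ : Cardinal.{u}} (hκ : ℵ₀ ≤ κ)
    {I : Order.Ideal (Set (Iio κ.ord))}
    (hsmall : ∀ X : Set (Iio κ.ord), #X < Cardinal.lift.{u + 1} κ → X ∈ I)
    (hnormal : IsNormal I) {A : Set (Iio κ.ord)} (hA : A ∉ I)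
    (hatom : ∀ X, A ∩ X ∈ I ∨ A \ X ∈ I) :
    ∃ U : Ultrafilter (Iio κ.ord), IsNormalUltrafilter U ∧ ∀ X, X ∈ U ↔ A ∩ X ∉ I := by
  have hiff : ∀ X, A \ X ∈ I ↔ A ∩ X ∉ I := fun X => by
    refine ⟨fun h h' => hA (I.lower ?_ (Order.Ideal.sup_mem h h')), (hatom X).resolve_left⟩
    exact (sdiff_union_inter A X).ge
  let F : Filter (Iio κ.ord) :=
    { sets := {X | A \ X ∈ I}
      univ_sets := by
        show A \ univ ∈ I
        rw [sdiff_univ]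
        exact I.bot_mem
      sets_of_superset := fun {X Y} hX hXY => I.lower (sdiff_subset_sdiff_right hXY) hX
      inter_sets := fun {X Y} hX hY => by
        show A \ (X ∩ Y) ∈ I
        rw [sdiff_inter]
        exact Order.Ideal.sup_mem hX hY }
  have hF : ∀ X, X ∈ F ↔ A \ X ∈ I := fun X => Iff.rfl
  let U := Ultrafilter.ofComplNotMemIff F fun X => by
    rw [hF, hF, hiff X, Set.sdiff_compl]
  have hU : ∀ X, X ∈ U ↔ A ∩ X ∉ I := hiff
  refine ⟨U, ⟨fun ξ => ?_, fun f hf => ?_⟩, hU⟩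
  · refine (hF _).2 (I.lower ?_ (Iic_mem hκ hsmall ξ))
    exact fun x hx => not_lt.1 (show ¬ ξ < x from hx.2)
  · obtain ⟨H, hHA, hH, γ, hγ⟩ := hnormal _ ((hU _).1 hf) f fun α hα => hα.2
    refine ⟨γ, (hU _).2 fun h => hH (I.lower ?_ h)⟩
    exact fun α hα => ⟨(hHA hα).1, hγ α hα⟩

/-! ### Łoś's theorem for families of elements coded by a common set -/

/-- `C` names elements of `M` and of every `N i` simultaneously. `hglue` takes the place of forming
arbitrary functions in an ultraproduct: counterexamples chosen separately for each `i` have a common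
name. -/
theorem realize_iff_eventually_realize {L : FirstOrder.Language} [L.IsRelational]
    {ι C M : Type*} {N : ι → Type*} [L.Structure M] [∀ i, L.Structure (N i)] (U : Ultrafilter ι)
    (v : C → M) (w : ∀ i, C → N i) (hv : Function.Surjective v)
    (hw : ∀ i, Function.Surjective (w i))
    (hglue : ∀ f : ι → C, ∃ c, ∀ᶠ i in U, w i c = w i (f i))
    (heq : ∀ c d, v c = v d ↔ ∀ᶠ i in U, w i c = w i d)
    (hrel : ∀ {n} (r : L.Relations n) (x : Fin n → C),
      FirstOrder.Language.Structure.RelMap r (v ∘ x) ↔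
        ∀ᶠ i in U, FirstOrder.Language.Structure.RelMap r (w i ∘ x))
    {β : Type*} (y : β → C) {n : ℕ} (φ : L.BoundedFormula β n) (x : Fin n → C) :
    φ.Realize (v ∘ y) (v ∘ x) ↔ ∀ᶠ i in U, φ.Realize (w i ∘ y) (w i ∘ x) := by
  have hterm : ∀ {n} (x : Fin n → C) (t : L.Term (β ⊕ Fin n)), ∃ c,
      t.realize (Sum.elim (v ∘ y) (v ∘ x)) = v c ∧
        ∀ i, t.realize (Sum.elim (w i ∘ y) (w i ∘ x)) = w i c := by
    intro n x t
    cases t with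
    | var a =>
      cases a with
      | inl b => exact ⟨y b, rfl, fun _ => rfl⟩
      | inr k => exact ⟨x k, rfl, fun _ => rfl⟩
    | func f ts => exact isEmptyElim f
  induction φ with
  | falsum => simp [FirstOrder.Language.BoundedFormula.Realize, U.neBot.ne]
  | equal t₁ t₂ =>
    obtain ⟨c, hc, hc'⟩ := hterm x t₁
    obtain ⟨d, hd, hd'⟩ := hterm x t₂
    simp only [FirstOrder.Language.BoundedFormula.Realize, hc, hc', hd, hd']
    exact heq c d
  | rel r ts =>
    choose c hc hc' using fun k => hterm x (ts k)
    simp only [FirstOrder.Language.BoundedFormula.Realize, hc, hc']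
    exact hrel r c
  | imp φ ψ ihφ ihψ =>
    simp only [FirstOrder.Language.BoundedFormula.Realize, ihφ, ihψ, Ultrafilter.eventually_imp]
  | all φ ih =>
    simp only [FirstOrder.Language.BoundedFormula.Realize]
    have hsnoc : ∀ c, φ.Realize (v ∘ y) (Fin.snoc (v ∘ x) (v c)) ↔
        ∀ᶠ i in U, φ.Realize (w i ∘ y) (Fin.snoc (w i ∘ x) (w i c)) := fun c => by
      have h := ih (Fin.snoc x c)
      simpa only [Fin.comp_snoc] using h
    constructor
    · intro h
      by_contra hcon
      rw [← Ultrafilter.eventually_not] at hcon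
      have hf : ∀ i, ∃ c, (¬ ∀ a, φ.Realize (w i ∘ y) (Fin.snoc (w i ∘ x) a)) →
          ¬ φ.Realize (w i ∘ y) (Fin.snoc (w i ∘ x) (w i c)) := fun i => by
        by_cases hi : ∀ a, φ.Realize (w i ∘ y) (Fin.snoc (w i ∘ x) a)
        · obtain ⟨m⟩ : Nonempty C := by
            by_contra hC
            rw [not_nonempty_iff] at hC
            obtain ⟨j, hj⟩ := hcon.exists
            exact hj fun a => isEmptyElim (hw j a).choose
          exact ⟨m, fun h => absurd hi h⟩
        · have hi' := hi
          push Not at hi'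
          obtain ⟨a, ha⟩ := hi'
          obtain ⟨c, rfl⟩ := hw i a
          exact ⟨c, fun _ => ha⟩
      choose f hf using hf
      obtain ⟨c, hc⟩ := hglue f
      have h1 := (hsnoc c).1 (h (v c))
      obtain ⟨i, ⟨h2, h3⟩, h4⟩ := ((hcon.and hc).and h1).exists
      refine hf i h2 ?_
      rw [← h3]
      exact h4
    · intro h a
      obtain ⟨c, rfl⟩ := hv a
      exact (hsnoc c).2 (h.mono fun i hi => hi _)

/-! ### Codes of sets by well-founded relations -/

/-- A code of a set over `ι`: a well-founded relation, to be collapsed, and the set of those nodes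
that collapse to the elements of the coded set. -/
structure RelCode (ι : Type*) where
  /-- The relation to be collapsed. -/
  rel : ι → ι → Prop
  wf : WellFounded rel
  /-- The nodes that collapse to the elements of the coded set. -/
  nodes : Set ι

section RelCode

variable {ι : Type*} [Small.{u} ι]

/-- The Mostowski collapse of the restriction to `B` of a well-founded relation. -/
noncomputable def collapse {R : ι → ι → Prop} (hR : WellFounded R) (B : Set ι) : ι → ZFSet.{u} :=
  hR.fix fun η ih => ZFSet.range fun ξ : {ξ // ξ ∈ B ∧ R ξ η} => ih ξ.1 ξ.2.2

theorem mem_collapse {R : ι → ι → Prop} (hR : WellFounded R) {B : Set ι} {η : ι} {x : ZFSet.{u}} :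
    x ∈ collapse hR B η ↔ ∃ ξ ∈ B, R ξ η ∧ collapse hR B ξ = x := by
  have h : collapse.{u} hR B η =
      ZFSet.range fun ξ : {ξ // ξ ∈ B ∧ R ξ η} => collapse hR B ξ.1 := hR.fix_eq _ _
  rw [h, ZFSet.mem_range]
  exact ⟨fun ⟨ξ, h⟩ => ⟨ξ.1, ξ.2.1, ξ.2.2, h⟩, fun ⟨ξ, h1, h2, h3⟩ => ⟨⟨ξ, h1, h2⟩, h3⟩⟩

theorem collapse_congr {R R' : ι → ι → Prop} (hR : WellFounded R) (hR' : WellFounded R')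
    {B : Set ι} (h : ∀ ξ ∈ B, ∀ η ∈ B, R ξ η ↔ R' ξ η) (η : ι) (hη : η ∈ B) :
    collapse.{u} hR B η = collapse hR' B η := by
  induction η using hR.induction with
  | _ η ih =>
    ext x
    rw [mem_collapse, mem_collapse]
    refine exists_congr fun ξ => and_congr_right fun hξ => ?_
    rw [← h ξ hξ η hη]
    exact and_congr_right fun hξη => by rw [ih ξ hξη hξ]

namespace RelCode

/-- The set coded by the restriction of a code to `B`. -/
noncomputable def val (c : RelCode ι) (B : Set ι) : ZFSet.{u} :=
  ZFSet.range fun ξ : {ξ // ξ ∈ c.nodes ∧ ξ ∈ B} => collapse c.wf B ξ.1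

theorem mem_val {c : RelCode ι} {B : Set ι} {x : ZFSet.{u}} :
    x ∈ c.val B ↔ ∃ ξ ∈ c.nodes, ξ ∈ B ∧ collapse c.wf B ξ = x := by
  rw [val, ZFSet.mem_range]
  exact ⟨fun ⟨ξ, h⟩ => ⟨ξ.1, ξ.2.1, ξ.2.2, h⟩, fun ⟨ξ, h1, h2, h3⟩ => ⟨⟨ξ, h1, h2⟩, h3⟩⟩

theorem val_congr {c d : RelCode ι} {B : Set ι} (hrel : ∀ ξ ∈ B, ∀ η ∈ B, c.rel ξ η ↔ d.rel ξ η)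
    (hnodes : ∀ ξ ∈ B, ξ ∈ c.nodes ↔ ξ ∈ d.nodes) : c.val.{u} B = d.val B := by
  ext x
  rw [mem_val, mem_val]
  refine exists_congr fun ξ => ⟨?_, ?_⟩
  · rintro ⟨h1, h2, rfl⟩
    exact ⟨(hnodes ξ h2).1 h1, h2, (collapse_congr c.wf d.wf hrel ξ h2).symm⟩
  · rintro ⟨h1, h2, rfl⟩
    exact ⟨(hnodes ξ h2).2 h1, h2, collapse_congr c.wf d.wf hrel ξ h2⟩

end RelCode

variable [LinearOrder ι] {U : Ultrafilter ι}

namespace IsNormalUltrafilter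

omit [Small.{u} ι] in
-- Extensionality turns equality into two inclusions, each a `∀∃` statement about nodes, to which
-- `forall_exists_iff` applies.
theorem eq_iff_eventually_eq (hU : IsNormalUltrafilter U) {A A' : Set ι}
    {F F' : Set ι → ι → ZFSet.{u}} {X X' : Set ι → ZFSet.{u}}
    (hX : ∀ B x, x ∈ X B ↔ ∃ ξ ∈ A, ξ ∈ B ∧ F B ξ = x)
    (hX' : ∀ B x, x ∈ X' B ↔ ∃ ξ ∈ A', ξ ∈ B ∧ F' B ξ = x)
    (h : ∀ ξ ∈ A, ∀ η ∈ A', F univ ξ = F' univ η ↔ ∀ᶠ α in U, F (Iio α) ξ = F' (Iio α) η) :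
    X univ = X' univ ↔ ∀ᶠ α in U, X (Iio α) = X' (Iio α) := by
  have key : ∀ {A A' : Set ι} {F F' : Set ι → ι → ZFSet.{u}} {X X' : Set ι → ZFSet.{u}}
      (B : Set ι),
      (∀ x, x ∈ X B ↔ ∃ ξ ∈ A, ξ ∈ B ∧ F B ξ = x) →
      (∀ x, x ∈ X' B ↔ ∃ ξ ∈ A', ξ ∈ B ∧ F' B ξ = x) →
      (X B ⊆ X' B ↔ ∀ ξ ∈ A, ξ ∈ B → ∃ η ∈ A', η ∈ B ∧ F B ξ = F' B η) := by
    intro A A' F F' X X' B hX hX'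
    constructor
    · intro hs ξ hξ hξB
      obtain ⟨η, h1, h2, h3⟩ := (hX' _).1 (hs ((hX _).2 ⟨ξ, hξ, hξB, rfl⟩))
      exact ⟨η, h1, h2, h3.symm⟩
    · intro hs x hx
      obtain ⟨ξ, hξ, hξB, rfl⟩ := (hX _).1 hx
      obtain ⟨η, h1, h2, h3⟩ := hs ξ hξ hξB
      exact (hX' _).2 ⟨η, h1, h2, h3.symm⟩
  have hsub : ∀ Y Z : ZFSet.{u}, Y = Z ↔ Y ⊆ Z ∧ Z ⊆ Y := fun Y Z =>
    ⟨fun h => h ▸ ⟨fun _ h => h, fun _ h => h⟩, fun h => ZFSet.ext fun x => ⟨@h.1 x, @h.2 x⟩⟩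
  simp only [hsub, Filter.eventually_and]
  refine and_congr ?_ ?_
  · simp only [key _ (hX _) (hX' _), mem_univ, true_and, true_imp_iff, mem_Iio]
    exact hU.forall_exists_iff (q := fun α ξ η => F (Iio α) ξ = F' (Iio α) η) h
  · simp only [key _ (hX' _) (hX _), mem_univ, true_and, true_imp_iff, mem_Iio]
    refine hU.forall_exists_iff (q := fun α η ξ => F' (Iio α) η = F (Iio α) ξ) fun η hη ξ hξ => ?_
    simp only [eq_comm (a := F' _ η)]
    exact h ξ hξ η hη

theorem collapse_eq_iff (hU : IsNormalUltrafilter U) {R S : ι → ι → Prop} (hR : WellFounded R)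
    (hS : WellFounded S) (ξ η : ι) :
    collapse.{u} hR univ ξ = collapse hS univ η ↔
      ∀ᶠ α in U, collapse.{u} hR (Iio α) ξ = collapse hS (Iio α) η := by
  induction ξ using hR.induction generalizing η with
  | _ ξ ih =>
    refine hU.eq_iff_eventually_eq (A := {ξ' | R ξ' ξ}) (A' := {η' | S η' η})
      (F := collapse hR) (F' := collapse hS) (X := fun B => collapse hR B ξ)
      (X' := fun B => collapse hS B η) (fun B x => ?_) (fun B x => ?_)
      fun ξ' hξ' η' _ => ih ξ' hξ' η'
    · rw [mem_collapse]
      exact exists_congr fun _ => and_left_comm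
    · rw [mem_collapse]
      exact exists_congr fun _ => and_left_comm

theorem val_eq_iff (hU : IsNormalUltrafilter U) (c d : RelCode ι) :
    c.val.{u} univ = d.val univ ↔ ∀ᶠ α in U, c.val.{u} (Iio α) = d.val (Iio α) :=
  hU.eq_iff_eventually_eq (fun _ _ => RelCode.mem_val) (fun _ _ => RelCode.mem_val)
    fun ξ _ η _ => hU.collapse_eq_iff c.wf d.wf ξ η

theorem val_mem_iff (hU : IsNormalUltrafilter U) (c d : RelCode ι) :
    c.val.{u} univ ∈ d.val.{u} univ ↔ ∀ᶠ α in U, c.val.{u} (Iio α) ∈ d.val.{u} (Iio α) := by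
  -- `e η` codes the collapse of the node `η`, so membership becomes equality with some `e η`.
  let e : ι → RelCode ι := fun η => ⟨d.rel, d.wf, {ξ | d.rel ξ η}⟩
  have he : ∀ B η, collapse.{u} d.wf B η = (e η).val B := fun B η => by
    ext x
    rw [mem_collapse, RelCode.mem_val]
    exact exists_congr fun _ => and_left_comm
  have hmem : ∀ B, c.val.{u} B ∈ d.val.{u} B ↔
      ∃ η ∈ d.nodes, η ∈ B ∧ c.val.{u} B = (e η).val B := fun B => by
    rw [RelCode.mem_val]
    refine exists_congr fun η => and_congr_right fun _ => and_congr_right fun _ => ?_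
    rw [he, eq_comm]
  simp only [hmem, mem_univ, true_and, mem_Iio]
  -- The universal variable is a dummy, later instantiated at `ξ₀`, which lies below almost every
  -- `α`.
  have h := hU.forall_exists_iff (A := univ) (A' := d.nodes)
    (p := fun _ η => c.val.{u} univ = (e η).val univ)
    (q := fun α _ η => c.val.{u} (Iio α) = (e η).val (Iio α))
    fun _ _ η _ => hU.val_eq_iff c (e η)
  obtain ⟨ξ₀, -⟩ := U.nonempty_of_mem Filter.univ_mem
  have h1 : (∃ η ∈ d.nodes, c.val.{u} univ = (e η).val univ) ↔
      ∀ ξ ∈ (univ : Set ι), ∃ η ∈ d.nodes, c.val.{u} univ = (e η).val univ :=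
    ⟨fun h _ _ => h, fun h => h ξ₀ (mem_univ _)⟩
  rw [h1, h]
  refine Filter.eventually_congr ?_
  filter_upwards [hU.eventually_gt ξ₀] with α hα
  exact ⟨fun h => h ξ₀ (mem_univ _) hα, fun h _ _ _ => h⟩

/-- The code `c` is the `U`-limit of the codes `f α`; by diagonal intersection it agrees with `f α`
below `α` for almost all `α`. -/
theorem exists_relCode_eventually_val_eq (hU : IsNormalUltrafilter U) (f : ι → RelCode ι) :
    ∃ c : RelCode ι, ∀ᶠ α in U, c.val.{u} (Iio α) = (f α).val (Iio α) := by
  have hdec : ∀ p : ι → Prop, ∀ᶠ α in U, (∀ᶠ β in U, p β) ↔ p α := fun p => by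
    by_cases h : ∀ᶠ β in U, p β
    · exact h.mono fun α hα => ⟨fun _ => hα, fun _ => h⟩
    · have h' := h
      rw [← Ultrafilter.eventually_not] at h'
      exact h'.mono fun α hα => ⟨fun h'' => absurd h'' h, fun h'' => absurd h'' hα⟩
  let R : ι → ι → Prop := fun ξ η => ∀ᶠ α in U, (f α).rel ξ η
  have hR : ∀ᶠ α in U, ∀ ξ < α, ∀ η < α, R ξ η ↔ (f α).rel ξ η :=
    hU.eventually_forall_lt fun ξ => hU.eventually_forall_lt fun η => hdec _
  have hA : ∀ᶠ α in U, ∀ ξ < α, ξ ∈ {ξ | ∀ᶠ α in U, ξ ∈ (f α).nodes} ↔ ξ ∈ (f α).nodes :=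
    hU.eventually_forall_lt fun ξ => hdec _
  -- If `W` had no minimal element, some `α` closed under the descent map `g` and agreeing with `R`
  -- would make `W ∩ α` a set without minimum for `(f α).rel`.
  have hwf : WellFounded R := by
    rw [WellFounded.wellFounded_iff_has_min]
    by_contra! hcon
    obtain ⟨W, ⟨w, hw⟩, hW⟩ := hcon
    choose! g hg hgR using hW
    have hclosed := hU.eventually_forall_lt fun ξ => hU.eventually_gt (g ξ)
    obtain ⟨α, ⟨h1, h2⟩, h3⟩ := ((hR.and hclosed).and (hU.eventually_gt w)).exists
    obtain ⟨m, ⟨hmW, hmα⟩, hm⟩ := (f α).wf.has_min (W ∩ Iio α) ⟨w, hw, h3⟩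
    exact hm (g m) ⟨hg m hmW, h2 m hmα⟩ ((h1 _ (h2 m hmα) _ hmα).1 (hgR m hmW))
  refine ⟨⟨R, hwf, {ξ | ∀ᶠ α in U, ξ ∈ (f α).nodes}⟩, ?_⟩
  filter_upwards [hR, hA] with α h1 h2
  exact RelCode.val_congr h1 h2

end IsNormalUltrafilter

end RelCode

/-! ### The elements of `H(κ⁺)` are coded over `κ` -/

section HSucc

variable {κ : Cardinal.{u}}

theorem RelCode.val_univ_mem_H (c : RelCode (Iio κ.ord)) : c.val univ ∈ H (Order.succ κ) := by
  refine ⟨ZFSet.range (collapse c.wf univ), ?_, ?_, ?_⟩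
  · intro y hy x hx
    obtain ⟨η, rfl⟩ := ZFSet.mem_range.1 hy
    obtain ⟨ξ, -, -, rfl⟩ := (mem_collapse c.wf).1 hx
    exact ZFSet.mem_range.2 ⟨ξ, rfl⟩
  · intro x hx
    obtain ⟨ξ, -, -, rfl⟩ := RelCode.mem_val.1 hx
    exact ZFSet.mem_range.2 ⟨ξ, rfl⟩
  · rw [Order.lt_succ_iff, ← Cardinal.lift_le.{u + 1}]
    have h := ZFSet.lift_card_range_le.{u + 1, u} (f := collapse c.wf univ)
    rwa [mk_Iio_ordinal, card_ord, Cardinal.lift_lift] at h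

/-- Membership on a transitive set containing the elements of `x` is copied to `κ` along an
injection; collapsing undoes the copying. -/
theorem exists_relCode_val_eq {x : ZFSet.{u}} (hx : x ∈ H (Order.succ κ)) :
    ∃ c : RelCode (Iio κ.ord), c.val univ = x := by
  obtain ⟨t, ht, hxt, hcard⟩ := hx
  have hle : #(t : Set ZFSet.{u}) ≤ #(Iio κ.ord) := by
    rw [mk_Iio_ordinal, card_ord]
    exact ZFSet.cardinalMk_coe_sort.le.trans (Cardinal.lift_le.2 (Order.lt_succ_iff.1 hcard))
  obtain ⟨h⟩ := hle
  let R : Iio κ.ord → Iio κ.ord → Prop := fun ξ η =>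
    ∃ u v : (t : Set ZFSet.{u}), h u = ξ ∧ h v = η ∧ u.1 ∈ v.1
  have hR : WellFounded R := by
    have hacc : ∀ y : ZFSet.{u}, ∀ hy : y ∈ t, Acc R (h ⟨y, hy⟩) := fun y => by
      induction y using ZFSet.inductionOn with
      | _ y ih =>
        intro hy
        refine ⟨_, ?_⟩
        rintro _ ⟨u, v, rfl, hv, huv⟩
        obtain rfl := h.injective hv
        exact ih u.1 huv u.2
    refine ⟨fun ξ => ⟨_, ?_⟩⟩
    rintro _ ⟨u, v, rfl, rfl, huv⟩
    exact hacc u.1 u.2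
  have hcol : ∀ y : ZFSet.{u}, ∀ hy : y ∈ t, collapse hR univ (h ⟨y, hy⟩) = y := fun y => by
    induction y using ZFSet.inductionOn with
    | _ y ih =>
      intro hy
      ext z
      rw [mem_collapse]
      constructor
      · rintro ⟨_, -, ⟨u, v, rfl, hv, huv⟩, rfl⟩
        obtain rfl := h.injective hv
        rwa [ih u.1 huv u.2]
      · intro hz
        have hzt := ht y hy hz
        exact ⟨h ⟨z, hzt⟩, mem_univ _, ⟨_, _, rfl, rfl, hz⟩, ih z hz hzt⟩
  refine ⟨⟨R, hR, {ξ | ∃ u : (t : Set ZFSet.{u}), h u = ξ ∧ u.1 ∈ x}⟩, ?_⟩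
  ext z
  rw [RelCode.mem_val]
  constructor
  · rintro ⟨_, ⟨u, rfl, hu⟩, -, rfl⟩
    change collapse hR univ (h u) ∈ x
    rwa [hcol u.1 u.2]
  · intro hz
    exact ⟨h ⟨z, hxt hz⟩, ⟨_, rfl, hz⟩, mem_univ _, hcol z (hxt hz)⟩

/-- The code of the set of von Neumann ordinals given by a subset of `κ`. -/
def ordCode (X : Set (Iio κ.ord)) : RelCode (Iio κ.ord) := ⟨(· < ·), wellFounded_lt, X⟩

theorem val_ordCode (X : Set (Iio κ.ord)) : (ordCode X).val univ = code X := by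
  have h : ∀ α : Iio κ.ord,
      collapse.{u} (wellFounded_lt : WellFounded ((· < ·) : Iio κ.ord → _ → Prop)) univ α =
        α.1.toZFSet := fun α => by
    induction α using WellFoundedLT.induction with
    | _ α ih =>
      ext x
      rw [mem_collapse, Ordinal.mem_toZFSet_iff]
      constructor
      · rintro ⟨ξ, -, hξ, rfl⟩
        exact ⟨ξ.1, hξ, (ih ξ hξ).symm⟩
      · rintro ⟨ξ, hξ, rfl⟩
        exact ⟨⟨ξ, lt_trans hξ (mem_Iio.1 α.2)⟩, mem_univ _, hξ, ih _ hξ⟩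
  ext x
  rw [RelCode.mem_val, code, ZFSet.mem_sep, Ordinal.mem_toZFSet_iff]
  constructor
  · rintro ⟨ξ, hξ, -, rfl⟩
    have h' := h ξ
    exact ⟨⟨ξ.1, ξ.2, h'.symm⟩, ξ, hξ, h'.symm⟩
  · rintro ⟨-, α, hα, rfl⟩
    exact ⟨α, hα, mem_univ _, h α⟩

theorem code_injective : Function.Injective (code : Set (Iio κ.ord) → ZFSet.{u}) := by
  have h : ∀ (X : Set (Iio κ.ord)) (α : Iio κ.ord), α.1.toZFSet ∈ code X ↔ α ∈ X := fun X α => by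
    rw [code, ZFSet.mem_sep]
    constructor
    · rintro ⟨-, β, hβ, h⟩
      rwa [← Subtype.ext (Ordinal.toZFSet_injective h)]
    · exact fun hα => ⟨Ordinal.toZFSet_mem_toZFSet_iff.2 α.2, α, hα, rfl⟩
  intro X Y hXY
  ext α
  rw [← h X, ← h Y, hXY]

/-- The sets coded by the restrictions of codes over `κ` to `α`. -/
def slice (α : Iio κ.ord) : Set ZFSet.{u} := range fun c : RelCode (Iio κ.ord) => c.val (Iio α)

instance instStructureSlice (α : Iio κ.ord) : setLanguage.Structure (slice α) where
  funMap := fun f => nomatch f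
  RelMap := fun r => match r with
    | .mem => fun v => (v 0 : ZFSet.{u}) ∈ (v 1 : ZFSet.{u})

/-- The element of `H(κ⁺)` given by a code. -/
noncomputable def valH (c : RelCode (Iio κ.ord)) : H (Order.succ κ) :=
  ⟨c.val univ, c.val_univ_mem_H⟩

/-- The element of `slice α` given by a code. -/
noncomputable def valSlice (α : Iio κ.ord) (c : RelCode (Iio κ.ord)) : slice α :=
  ⟨c.val (Iio α), c, rfl⟩

theorem IsNormalUltrafilter.realize_valH_iff {U : Ultrafilter (Iio κ.ord)}
    (hU : IsNormalUltrafilter U) {β : Type*} (φ : setLanguage.Formula β)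
    (y : β → RelCode (Iio κ.ord)) :
    φ.Realize (valH ∘ y) ↔ ∀ᶠ α in U, φ.Realize (valSlice α ∘ y) := by
  have : setLanguage.IsRelational := fun _ => inferInstanceAs (IsEmpty Empty)
  have h := realize_iff_eventually_realize U valH valSlice
    (fun x => by
      obtain ⟨c, hc⟩ := exists_relCode_val_eq x.2
      exact ⟨c, Subtype.ext hc⟩)
    (fun α x => by
      obtain ⟨c, hc⟩ := x.2
      exact ⟨c, Subtype.ext hc⟩)
    (fun f => by
      obtain ⟨c, hc⟩ := hU.exists_relCode_eventually_val_eq f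
      exact ⟨c, hc.mono fun _ h => Subtype.ext h⟩)
    (fun c d => by
      simp only [Subtype.ext_iff]
      exact hU.val_eq_iff c d)
    (fun r x => by
      cases r
      exact hU.val_mem_iff (x 0) (x 1))
    y φ default
  rw [FirstOrder.Language.Formula.Realize, ← Unique.eq_default (valH ∘ default), h]
  refine Filter.eventually_congr (Filter.Eventually.of_forall fun α => ?_)
  rw [FirstOrder.Language.Formula.Realize, Unique.eq_default (valSlice α ∘ default)]

end HSucc

end SetIdeal

/-! ### The main theorem -/

theorem mainTheorem8 (κ : Cardinal.{u}) (hκ : SetIdeal.IsWeaklyCompact κ)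
    (I : Order.Ideal (Set (Set.Iio κ.ord)))
    (hsmall : ∀ X : Set (Set.Iio κ.ord), Cardinal.mk X < Cardinal.lift.{u + 1} κ → X ∈ I)
    (hnormal : SetIdeal.IsNormal I)
    (hdef : SetIdeal.IsDefinableOverH I) :
    SetIdeal.IsNowhereSaturated I κ := by
  intro S hS hsat
  obtain ⟨A, hA, hatom⟩ := SetIdeal.exists_atom hκ hsmall hnormal hS hsat
  obtain ⟨U, hU, hUA⟩ := SetIdeal.exists_isNormalUltrafilter hκ.isInaccessible.aleph0_lt.le
    hsmall hnormal hA hatom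
  obtain ⟨φ, hφ⟩ := Set.definable_iff_exists_formula_sum.1 hdef
  -- Every parameter gets a fixed code, independent of `X`, so that in a slice only the last
  -- variable depends on `X`.
  choose p hp using fun a : (Set.univ : Set (SetIdeal.H (Order.succ κ))) =>
    SetIdeal.exists_relCode_val_eq a.1.2
  let y : Set (Set.Iio κ.ord) → _ ⊕ Fin 1 → SetIdeal.RelCode (Set.Iio κ.ord) :=
    fun X => Sum.elim p fun _ => SetIdeal.ordCode X
  have hI : ∀ X, X ∈ I ↔ ∀ᶠ α in U, φ.Realize (SetIdeal.valSlice α ∘ y X) := fun X => by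
    rw [← hU.realize_valH_iff φ (y X)]
    have h1 := Set.ext_iff.1 hφ fun _ => SetIdeal.valH (SetIdeal.ordCode X)
    have h2 : SetIdeal.valH ∘ y X =
        Sum.elim (↑) fun _ => SetIdeal.valH (SetIdeal.ordCode X) := by
      funext a
      cases a with
      | inl a => exact Subtype.ext (hp a)
      | inr _ => rfl
    rw [h2]
    refine Iff.trans ?_ h1
    constructor
    · exact fun hX => ⟨X, hX, (SetIdeal.val_ordCode X).symm⟩
    · rintro ⟨Y, hY, hYX⟩
      exact SetIdeal.code_injective (hYX.trans (SetIdeal.val_ordCode X)) ▸ hY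
  refine SetIdeal.not_forall_mem_iff_eventually_inter_Iio U
    (fun α Y => ¬ φ.Realize (SetIdeal.valSlice α ∘ y (A ∩ Y))) fun X => ?_
  rw [hUA, hI, ← Ultrafilter.eventually_not]
  refine Filter.eventually_congr (Filter.Eventually.of_forall fun α => ?_)
  -- The slice at `α` sees only the nodes below `α`, hence only `X ∩ α`.
  have h : SetIdeal.valSlice α ∘ y (A ∩ X) = SetIdeal.valSlice α ∘ y (A ∩ (X ∩ Set.Iio α)) := by
    funext a
    cases a with
    | inl a => rfl
    | inr _ =>
      exact Subtype.ext (SetIdeal.RelCode.val_congr (fun _ _ _ _ => Iff.rfl)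
        fun ξ hξ => ⟨fun h => ⟨h.1, h.2, hξ⟩, fun h => ⟨h.1, h.2.1⟩⟩)
  rw [h]
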